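/- Fix a parameter value $\theta$ (omitted from the notation). Let $\mathsf X$ be the state space of a signal at the observation times, $\mathbf X$ the space of the augmented (pathspace) variable $\mathbf x'$ attached to the move from a state $x$ over one inter-observation interval (for a jump-diffusion it encodes the path over that interval), and $\mu$ a $\sigma$-finite reference measure on $\mathbf X$. Given $x$, the variable $\mathbf x'$ has law $p(d\mathbf x'|x)=p(\mathbf x'|x)\,\mu(d\mathbf x')$, and the next state $x'$ is a measurable function of $\mathbf x'$. Let $p(dx_0)$ be the law of $x_0=\mathbf x_0$; given the signal, the observation $y_k$ at time $k$ has density $g(y_k|x_k)$. Fix observations $y_0,y_1,\dots$, and put $$p(d\mathbf x_{0:n}|y_{0:n})\propto p(dx_0)\prod_{k=1}^n p(\mathbf x_k|x_{k-1})\,\mu(d\mathbf x_k)\prod_{k=0}^n g(y_k|x_k),\qquad \mathcal S_n=\int\Big(s_0(x_0)+\sum_{k=1}^n s_k(x_{k-1},\mathbf x_k)\Big)\,p(d\mathbf x_{0:n}|y_{0:n}),$$ where the functions $s_k$ are measurable and each $s_k$ is bounded. Forward-only particle smoother with $N\ge1$ particles: draw $x_0^{(i)}$, $1\le i\le N$,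 i.i.d. from $p(dx_0)$ and set $W_0^{(i)}\propto g(y_0|x_0^{(i)})$ (normalised to sum to one), $\widehat T_0^{(i)}=s_0(x_0^{(i)})$. For $n\ge1$, conditionally on all previous particles, draw $\mathbf x_n^{(i)}$, $1\le i\le N$, independently from $\sum_{j=1}^N W_{n-1}^{(j)}\,p(d\mathbf x_n|x_{n-1}^{(j)})$, and set $W_n^{(i)}\propto g(y_n|x_n^{(i)})$ and $$\widehat T_n^{(i)}=\frac{\sum_{j=1}^N W_{n-1}^{(j)}\,p(\mathbf x_n^{(i)}|x_{n-1}^{(j)})\,\big[\widehat T_{n-1}^{(j)}+s_n(x_{n-1}^{(j)},\mathbf x_n^{(i)})\big]}{\sum_{l=1}^N W_{n-1}^{(l)}\,p(\mathbf x_n^{(i)}|x_{n-1}^{(l)})},\qquad \widehat{\mathcal S}_n=\widehat{\mathcal S}_n^{N}=\sum_{i=1}^N W_n^{(i)}\,\widehat T_n^{(i)}.$$ Assume that $g$ is positive, that $\sup_{x}g(y|x)<\infty$ for every $y$, and that $\sup_{x,\mathbf x'}p(\mathbf x'|x)<\infty$. Then, for every $n\ge0$: (i) there are constants $b_n,c_n>0$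 such that, for all $N\ge1$ and all $\varepsilon>0$, $$\mathrm{Prob}\big[\,|\mathcal S_n-\widehat{\mathcal S}_n^{N}|>\varepsilon\,\big]\le b_n\,e^{-c_nN\varepsilon^2};$$ (ii) if the particle systems for all $N\ge 1$ are defined on one probability space (with an arbitrary joint law across $N$), then $\widehat{\mathcal S}_n^{N}\to\mathcal S_n$ almost surely as $N\to\infty$. -/

import Mathlib

open MeasureTheory Filter Topology
open scoped ENNReal NNReal

noncomputable section

namespace PathspaceSmoothing

/-- A state-space model with augmented (pathspace) transitions, at a fixed parameter value.
`X` is the state space of the signal `x` at the observation times, `Z` is the space of the augmented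
variable `𝐱'` attached to the move from `x` over one inter-observation interval, and `Y` is the
observation space. Conditionally on `x`, the variable `𝐱'` has density `dens x` with respect to the
reference measure `ref`; the next state `x'` is the component `endpoint 𝐱'` of `𝐱'`.
Conditionally on the signal, an observation has density `obs · x` with respect to `obsRef`, where `x`
is the current state. -/
structure Model (X Z Y : Type*) [MeasurableSpace X] [MeasurableSpace Z] [MeasurableSpace Y] where
  /-- the law of `x₀` -/
  init : Measure X
  init_prob : IsProbabilityMeasure init
  /-- the reference measure `μ(d𝐱')` -/
  ref : Measure Z
  ref_sigmaFinite : SigmaFinite ref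
  /-- the end point `x'` of `𝐱'` -/
  endpoint : Z → X
  endpoint_meas : Measurable endpoint
  /-- `dens x 𝐱'` is the transition density `p(𝐱' | x)` -/
  dens : X → Z → ℝ≥0
  dens_meas : Measurable (Function.uncurry dens)
  dens_lintegral : ∀ x, ∫⁻ z, (dens x z : ℝ≥0∞) ∂ref = 1
  /-- the reference measure on observations (Lebesgue measure, say) -/
  obsRef : Measure Y
  /-- `obs y x` is the observation density `g(y | x)` -/
  obs : Y → X → ℝ≥0
  obs_meas : Measurable (Function.uncurry obs)
  obs_lintegral : ∀ x, ∫⁻ y, (obs y x : ℝ≥0∞) ∂obsRef = 1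

/-- An additive functional `S(𝐱_{0:n}) = s₀(x₀) + ∑_{k=1}^n s_k(x_{k-1}, 𝐱_k)`, for all `n` at once:
`init` is `s₀` and `step k` is `s_{k+1}`. -/
structure AdditiveFunctional (X Z : Type*) [MeasurableSpace X] [MeasurableSpace Z] where
  init : X → ℝ
  init_meas : Measurable init
  step : ℕ → X → Z → ℝ
  step_meas : ∀ k, Measurable (Function.uncurry (step k))

/-- The value of the additive functional is bounded at each time step. -/
def AdditiveFunctional.IsBounded {X Z : Type*} [MeasurableSpace X] [MeasurableSpace Z]
    (s : AdditiveFunctional X Z) : Prop :=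
  (∃ C : ℝ, ∀ x, |s.init x| ≤ C) ∧ ∀ k, ∃ C : ℝ, ∀ x z, |s.step k x z| ≤ C

namespace Model

variable {X Z Y : Type*} [MeasurableSpace X] [MeasurableSpace Z] [MeasurableSpace Y]
variable (M : Model X Z Y)

/-- The transition law `p(d𝐱' | x)`. -/
def trans (x : X) : Measure Z := M.ref.withDensity fun z => (M.dens x z : ℝ≥0∞)

/-! ### The smoothing distribution

An augmented path `𝐱_{0:n}` is a pair `h`: `h.1` is `x₀ = 𝐱₀` and `h.2 k` is `𝐱_{k+1}`. -/

/-- The states `x₀, …, x_n` of an augmented path. -/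
def states {n : ℕ} (h : X × (Fin n → Z)) : Fin (n + 1) → X :=
  Fin.cons h.1 fun k => M.endpoint (h.2 k)

/-- The law of `𝐱_{0:n}`, namely `p(dx₀) ∏_{k=1}^n p(𝐱_k | x_{k-1}) μ(d𝐱_k)`. -/
def signalLaw (n : ℕ) : Measure (X × (Fin n → Z)) :=
  (M.init.prod (Measure.pi fun _ : Fin n => M.ref)).withDensity fun h =>
    ∏ k : Fin n, (M.dens (M.states h k.castSucc) (h.2 k) : ℝ≥0∞)

/-- The likelihood `∏_{k=0}^n g(y_k | x_k)`. -/
def likelihood (y : ℕ → Y) {n : ℕ} (h : X × (Fin n → Z)) : ℝ≥0∞ :=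
  ∏ k : Fin (n + 1), (M.obs (y k) (M.states h k) : ℝ≥0∞)

/-- The smoothing distribution `p(d𝐱_{0:n} | y_{0:n})`, by Bayes' formula. -/
def smoothingLaw (y : ℕ → Y) (n : ℕ) : Measure (X × (Fin n → Z)) :=
  (∫⁻ h, M.likelihood y h ∂M.signalLaw n)⁻¹ • (M.signalLaw n).withDensity (M.likelihood y)

/-- The value `S(𝐱_{0:n})` of the additive functional along an augmented path. -/
def pathValue (s : AdditiveFunctional X Z) {n : ℕ} (h : X × (Fin n → Z)) : ℝ :=
  s.init h.1 + ∑ k : Fin n, s.step k (M.states h k.castSucc) (h.2 k)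

/-- The smoothing expectation `𝒮_n = ∫ S(𝐱_{0:n}) p(d𝐱_{0:n} | y_{0:n})`. -/
def smoothingExpectation (y : ℕ → Y) (s : AdditiveFunctional X Z) (n : ℕ) : ℝ :=
  ∫ h, M.pathValue s h ∂M.smoothingLaw y n

/-! ### The forward-only particle smoother

The particles are `x₀ i = x₀^{(i)}` and `z k i = 𝐱_{k+1}^{(i)}`. -/

/-- The states `x_k^{(i)}` of the particles. -/
def particle {N : ℕ} (x₀ : Fin N → X) (z : ℕ → Fin N → Z) : ℕ → Fin N → X
  | 0, i => x₀ i
  | k + 1, i => M.endpoint (z k i)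

/-- The normalised weights `W_k^{(i)} ∝ g(y_k | x_k^{(i)})`. -/
def weight (y : ℕ → Y) {N : ℕ} (x₀ : Fin N → X) (z : ℕ → Fin N → Z) (k : ℕ) (i : Fin N) : ℝ≥0 :=
  M.obs (y k) (M.particle x₀ z k i) / ∑ l, M.obs (y k) (M.particle x₀ z k l)

/-- The mixture `∑_j W_k^{(j)} p(d𝐱_{k+1} | x_k^{(j)})` from which the particles at time `k + 1` are
drawn. -/
def proposal (y : ℕ → Y) {N : ℕ} (x₀ : Fin N → X) (z : ℕ → Fin N → Z) (k : ℕ) : Measure Z :=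
  ∑ j, (M.weight y x₀ z k j : ℝ≥0∞) • M.trans (M.particle x₀ z k j)

/-- The recursively computed functionals `T̂_k(𝐱_k^{(i)})`. -/
def functional (y : ℕ → Y) (s : AdditiveFunctional X Z) {N : ℕ} (x₀ : Fin N → X)
    (z : ℕ → Fin N → Z) : ℕ → Fin N → ℝ
  | 0, i => s.init (x₀ i)
  | k + 1, i =>
      (∑ j, (M.weight y x₀ z k j : ℝ) * M.dens (M.particle x₀ z k j) (z k i) *
          (functional y s x₀ z k j + s.step k (M.particle x₀ z k j) (z k i))) /
        ∑ l, (M.weight y x₀ z k l : ℝ) * M.dens (M.particle x₀ z k l) (z k i)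

/-- The estimate `Ŝ_n = ∑_i W_n^{(i)} T̂_n(𝐱_n^{(i)})`. -/
def estimate (y : ℕ → Y) (s : AdditiveFunctional X Z) {N : ℕ} (x₀ : Fin N → X)
    (z : ℕ → Fin N → Z) (n : ℕ) : ℝ :=
  ∑ i, (M.weight y x₀ z n i : ℝ) * M.functional y s x₀ z n i

/-- `x₀, z` are the random particles generated by the algorithm with `N` particles: the initial
particles are independent with the law of the initial state and, conditionally on all particles up to
time `k`, the particles at time `k + 1` are independent draws from the mixture `proposal`. -/
structure IsParticleSystem (y : ℕ → Y) {N : ℕ} {Ω : Type*} [MeasurableSpace Ω] (P : Measure Ω)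
    (x₀ : Ω → Fin N → X) (z : Ω → ℕ → Fin N → Z) : Prop where
  meas_init : Measurable x₀
  meas_step : Measurable z
  law_init : P.map x₀ = Measure.pi fun _ => M.init
  law_step : ∀ (k : ℕ) (B : Set ((Fin N → X) × (Fin k → Fin N → Z))) (A : Fin N → Set Z),
    MeasurableSet B → (∀ i, MeasurableSet (A i)) →
      P {ω | (x₀ ω, fun j : Fin k => z ω j) ∈ B ∧ ∀ i, z ω k i ∈ A i} =
        ∫⁻ ω in {ω | (x₀ ω, fun j : Fin k => z ω j) ∈ B},
          ∏ i, M.proposal y (x₀ ω) (z ω) k (A i) ∂P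

end Model

end PathspaceSmoothing

end

/-! The class of statistics `f(x_n) T̂_n + h(x_n)`, with `f` and `h` bounded, is stable under one
step of the algorithm. The density of the proposal mixture is exactly the denominator of the update
of `T̂`, so averaging `g(x') (f(x') T̂_{n+1} + h(x'))` over a fresh particle cancels that
denominator. What remains is the weighted mean of `f'(x_n) T̂_n + h'(x_n)`, where `f'` integrates `g
f` and `h'` integrates `g f s_{n+1} + g h` against the transition law
(`integral_mixture_backwardMean`). The exact unnormalised smoothing functional obeys the same
recursion `(f, h) ↦ (f', h')` (`unnormalized_succ`).

Given the past, the new particles are i.i.d., and `T̂` is bounded uniformly in `N` because it is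
built from weighted averages. Conditional Hoeffding (`hoeffding_cond`) therefore controls the
sampling error of each step, and induction on `n` over all `f`, `h` at once gives the exponential
bound. Normalisation is a ratio of two such means, whose limiting denominator is positive. Taking `f
= 1`, `h = 0` gives (i). Since the bound is summable in `N`, Borel–Cantelli gives (ii) for any
coupling across `N`. -/

noncomputable section

/-! ### Hoeffding's inequality, plain and conditional. -/

namespace PathspaceSmoothing

open ProbabilityTheory

/-- **Hoeffding's inequality** for the empirical mean of a bounded function of i.i.d. variables. -/
lemma hoeffding_pi {Z : Type*} [MeasurableSpace Z] {N : ℕ} (hN : 1 ≤ N) (ν : Measure Z)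
    [IsProbabilityMeasure ν] {a : Z → ℝ} (ha : Measurable a) {B : ℝ} (hB : 0 < B)
    (haB : ∀ z, |a z| ≤ B) {ε : ℝ} (hε : 0 < ε) :
    (Measure.pi fun _ : Fin N => ν).real {z | ε < |(∑ i, a (z i)) / N - ∫ z, a z ∂ν|} ≤
      2 * Real.exp (-(1 / (2 * B ^ 2)) * N * ε ^ 2) := by
  set π := Measure.pi fun _ : Fin N => ν
  have hN0 : (0 : ℝ) < N := by exact_mod_cast hN
  -- The one-sided bound is kept general in `a`, since the two-sided one applies it to `a` and to
  -- `-a`.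
  have key : ∀ a : Z → ℝ, Measurable a → (∀ z, |a z| ≤ B) →
      π.real {z | N * ε ≤ ∑ i, (a (z i) - ∫ z, a z ∂ν)} ≤
        Real.exp (-(1 / (2 * B ^ 2)) * N * ε ^ 2) := by
    intro a ha haB
    have hsub : HasSubgaussianMGF (fun z => a z - ∫ z, a z ∂ν) ((‖B - -B‖₊ / 2) ^ 2) ν :=
      hasSubgaussianMGF_of_mem_Icc ha.aemeasurable (ae_of_all _ fun z => abs_le.1 (haB z))
    have hsub' : ∀ i : Fin N, HasSubgaussianMGF (fun z : Fin N → Z => a (z i) - ∫ z, a z ∂ν)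
        ((‖B - -B‖₊ / 2) ^ 2) π := by
      intro i
      have hmp : MeasurePreserving (Function.eval i) π ν := measurePreserving_eval _ i
      rw [← hmp.map_eq] at hsub
      have := HasSubgaussianMGF.of_map hmp.measurable.aemeasurable hsub
      simpa [Function.comp_def, hmp.map_eq] using this
    have hind : iIndepFun (fun (i : Fin N) (z : Fin N → Z) => a (z i) - ∫ z, a z ∂ν) π :=
      iIndepFun_pi (X := fun _ z => a z - ∫ z, a z ∂ν)
        fun _ => (ha.sub_const _).aemeasurable
    -- A range of length `2B` gives variance proxy `B²` per summand, so the exponent at threshold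
    -- `Nε` is `-(Nε)² / (2NB²)`.
    refine (HasSubgaussianMGF.measure_sum_ge_le_of_iIndepFun hind (fun i _ => hsub' i) (by positivity)).trans
      (le_of_eq ?_)
    congr 1
    have : ‖B - -B‖ = 2 * B := by rw [Real.norm_eq_abs, abs_of_pos] <;> linarith
    simp only [Finset.sum_const, Finset.card_univ, Fintype.card_fin, nsmul_eq_mul]
    push_cast
    rw [this]
    field_simp
  have hset : {z : Fin N → Z | ε < |(∑ i, a (z i)) / N - ∫ z, a z ∂ν|} ⊆
      {z | N * ε ≤ ∑ i, (a (z i) - ∫ z, a z ∂ν)} ∪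
        {z | N * ε ≤ ∑ i, (-a (z i) - ∫ z, -a z ∂ν)} := by
    intro z hz
    have h1 : (∑ i, a (z i)) / N - ∫ z, a z ∂ν = (∑ i, (a (z i) - ∫ z, a z ∂ν)) / N := by
      rw [Finset.sum_sub_distrib]
      simp only [Finset.sum_const, Finset.card_univ, Fintype.card_fin, nsmul_eq_mul]
      field_simp
    have h2 : ∑ i, (-a (z i) - ∫ z, -a z ∂ν) = -∑ i, (a (z i) - ∫ z, a z ∂ν) := by
      rw [integral_neg, ← Finset.sum_neg_distrib]
      exact Finset.sum_congr rfl fun i _ => by ring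
    simp only [Set.mem_ofPred_eq, Set.mem_union] at hz ⊢
    rw [h2]
    rw [h1, abs_div, abs_of_pos hN0, lt_div_iff₀ hN0, lt_abs] at hz
    rcases hz with hz | hz
    · left; linarith
    · right; linarith
  calc _ ≤ _ := measureReal_mono hset
    _ ≤ _ := measureReal_union_le _ _
    _ ≤ _ := add_le_add (key a ha haB) (key (fun z => -a z) ha.neg fun z => by
        rw [abs_neg]; exact haB z)
    _ = _ := by ring

/-- The kernel of `N` independent draws from a Markov kernel. -/
def iidKernel {S Z : Type*} [MeasurableSpace S] [MeasurableSpace Z] (κ : Kernel S Z)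
    [IsMarkovKernel κ] (N : ℕ) : Kernel S (Fin N → Z) where
  toFun σ := Measure.pi fun _ => κ σ
  measurable' := by
    refine Measurable.measure_of_isPiSystem_of_isProbabilityMeasure generateFrom_pi.symm
      isPiSystem_pi ?_
    rintro _ ⟨A, hA, rfl⟩
    simp only [Measure.pi_pi]
    exact Finset.measurable_prod _ fun i _ => κ.measurable_coe (hA i (Set.mem_univ i))

lemma iidKernel_apply {S Z : Type*} [MeasurableSpace S] [MeasurableSpace Z] (κ : Kernel S Z)
    [IsMarkovKernel κ] (N : ℕ) (σ : S) : iidKernel κ N σ = Measure.pi fun _ => κ σ := rfl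

instance {S Z : Type*} [MeasurableSpace S] [MeasurableSpace Z] (κ : Kernel S Z)
    [IsMarkovKernel κ] (N : ℕ) : IsMarkovKernel (iidKernel κ N) :=
  ⟨fun σ => by rw [iidKernel_apply]; infer_instance⟩

/-- A joint law is determined by the law of `σ` and the conditional law of independent draws. -/
lemma map_prodMk_eq_compProd {S Z Ω : Type*} [MeasurableSpace S] [MeasurableSpace Z]
    [MeasurableSpace Ω] {P : Measure Ω} [IsProbabilityMeasure P] {N : ℕ} {σ : Ω → S}
    {ζ : Ω → Fin N → Z} (hσ : Measurable σ) (hζ : Measurable ζ) (κ : Kernel S Z)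
    [IsMarkovKernel κ]
    (hlaw : ∀ (C : Set S) (A : Fin N → Set Z), MeasurableSet C → (∀ i, MeasurableSet (A i)) →
      P {ω | σ ω ∈ C ∧ ∀ i, ζ ω i ∈ A i} = ∫⁻ ω in σ ⁻¹' C, ∏ i, κ (σ ω) (A i) ∂P) :
    P.map (fun ω => (σ ω, ζ ω)) = (P.map σ) ⊗ₘ iidKernel κ N := by
  have := Measure.isProbabilityMeasure_map (μ := P) hσ.aemeasurable
  have := Measure.isProbabilityMeasure_map (μ := P) (hσ.prodMk hζ).aemeasurable
  have hrect : ∀ (C : Set S) (A : Fin N → Set Z), MeasurableSet C → (∀ i, MeasurableSet (A i)) →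
      P.map (fun ω => (σ ω, ζ ω)) (C ×ˢ Set.univ.pi A) =
        ((P.map σ) ⊗ₘ iidKernel κ N) (C ×ˢ Set.univ.pi A) := by
    intro C A hC hA
    have hA' : MeasurableSet (Set.univ.pi A) := MeasurableSet.univ_pi hA
    rw [Measure.map_apply (hσ.prodMk hζ) (hC.prod hA'), Measure.compProd_apply_prod hC hA',
      setLIntegral_map hC ((iidKernel κ N).measurable_coe hA') hσ]
    simp only [iidKernel_apply, Measure.pi_pi]
    rw [← hlaw C A hC hA]
    congr 1
    ext ω
    simp
  let 𝒞 : Set (Set (S × (Fin N → Z))) :=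
    Set.image2 (· ×ˢ ·) {C | MeasurableSet C}
      (Set.univ.pi '' Set.univ.pi fun _ : Fin N => {A : Set Z | MeasurableSet A})
  refine ext_of_generate_finite 𝒞 ?_ ?_ ?_ (by simp)
  · refine (generateFrom_eq_prod (C := {C : Set S | MeasurableSet C})
      MeasurableSpace.generateFrom_measurableSet generateFrom_pi
      ⟨fun _ => Set.univ, fun _ => MeasurableSet.univ, Set.iUnion_const _⟩
      ⟨fun _ => Set.univ, fun _ => ⟨fun _ => Set.univ, by simp, by simp⟩,
        Set.iUnion_const _⟩).symm
  · exact MeasurableSpace.isPiSystem_measurableSet.prod isPiSystem_pi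
  · rintro _ ⟨C, hC, _, ⟨A, hA, rfl⟩, rfl⟩
    exact hrect C A hC fun i => hA i (Set.mem_univ i)

/-- **Hoeffding's inequality** for draws that are i.i.d. conditionally on `σ`. -/
lemma hoeffding_cond {S Z Ω : Type*} [MeasurableSpace S] [MeasurableSpace Z]
    [MeasurableSpace Ω] {P : Measure Ω} [IsProbabilityMeasure P] {N : ℕ} (hN : 1 ≤ N) {σ : Ω → S}
    {ζ : Ω → Fin N → Z} (hσ : Measurable σ) (hζ : Measurable ζ) (κ : Kernel S Z)
    [IsMarkovKernel κ]
    (hlaw : ∀ (C : Set S) (A : Fin N → Set Z), MeasurableSet C → (∀ i, MeasurableSet (A i)) →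
      P {ω | σ ω ∈ C ∧ ∀ i, ζ ω i ∈ A i} = ∫⁻ ω in σ ⁻¹' C, ∏ i, κ (σ ω) (A i) ∂P)
    {a : S → Z → ℝ} (ha : Measurable (Function.uncurry a)) {B : ℝ} (hB : 0 < B)
    (haB : ∀ σ z, |a σ z| ≤ B) {ε : ℝ} (hε : 0 < ε) :
    P.real {ω | ε < |(∑ i, a (σ ω) (ζ ω i)) / N - ∫ z, a (σ ω) z ∂κ (σ ω)|} ≤
      2 * Real.exp (-(1 / (2 * B ^ 2)) * N * ε ^ 2) := by
  have := Measure.isProbabilityMeasure_map (μ := P) hσ.aemeasurable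
  let D : Set (S × (Fin N → Z)) :=
    {p | ε < |(∑ i, a p.1 (p.2 i)) / N - ∫ z, a p.1 z ∂κ p.1|}
  have hint : Measurable fun σ => ∫ z, a σ z ∂κ σ :=
    (ha.stronglyMeasurable.integral_kernel_prod_right (κ := κ)).measurable
  have hD : MeasurableSet D := by
    refine measurableSet_lt measurable_const (Measurable.abs (Measurable.sub ?_
      (hint.comp measurable_fst)))
    refine (Finset.measurable_sum _ fun i _ => ?_).div_const _
    exact ha.comp (measurable_fst.prodMk ((measurable_pi_apply i).comp measurable_snd))
  have h1 : P {ω | ε < |(∑ i, a (σ ω) (ζ ω i)) / N - ∫ z, a (σ ω) z ∂κ (σ ω)|} =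
      P.map (fun ω => (σ ω, ζ ω)) D := by
    rw [Measure.map_apply (hσ.prodMk hζ) hD]; rfl
  rw [measureReal_def, h1, map_prodMk_eq_compProd hσ hζ κ hlaw, Measure.compProd_apply hD]
  refine ENNReal.toReal_le_of_le_ofReal (by positivity) ?_
  -- The bound on each section does not depend on `s`, so it survives integration over the law of
  -- `σ`.
  calc ∫⁻ s, iidKernel κ N s (Prod.mk s ⁻¹' D) ∂P.map σ
      ≤ ∫⁻ _, ENNReal.ofReal (2 * Real.exp (-(1 / (2 * B ^ 2)) * N * ε ^ 2)) ∂P.map σ := by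
        refine lintegral_mono fun s => ?_
        have := hoeffding_pi hN (κ s) (a := a s) (ha.comp measurable_prodMk_left) hB (haB s) hε
        rw [measureReal_def] at this
        exact (ENNReal.le_ofReal_iff_toReal_le (measure_ne_top _ _) (by positivity)).2 this
    _ = _ := by simp

end PathspaceSmoothing

/-! ### Transition laws, proposal mixtures and the backward mean. -/

namespace PathspaceSmoothing

open ProbabilityTheory

namespace Model

variable {X Z Y : Type*} [MeasurableSpace X] [MeasurableSpace Z] [MeasurableSpace Y]
variable (M : Model X Z Y)

lemma measurable_dens {α : Type*} [MeasurableSpace α] {f : α → X} {g : α → Z} (hf : Measurable f)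
    (hg : Measurable g) : Measurable fun a => M.dens (f a) (g a) :=
  M.dens_meas.comp (hf.prodMk hg)

lemma measurable_dens_right (x : X) : Measurable (M.dens x) :=
  M.dens_meas.comp measurable_prodMk_left

lemma measurable_obs (v : Y) : Measurable (M.obs v) := M.obs_meas.comp measurable_prodMk_left

lemma nonempty_state (M : Model X Z Y) : Nonempty X :=
  have := M.init_prob
  M.init.nonempty_of_neZero

lemma nonempty_augmented (M : Model X Z Y) : Nonempty Z := by
  obtain ⟨x⟩ := M.nonempty_state
  by_contra h
  rw [not_nonempty_iff] at h
  simpa using M.dens_lintegral x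

/-- The transition law as a kernel. -/
def transKernel : Kernel X Z where
  toFun := M.trans
  measurable' := by
    have := M.ref_sigmaFinite
    refine Measure.measurable_of_measurable_coe _ fun A hA => ?_
    simp only [trans, withDensity_apply _ hA]
    exact Measurable.lintegral_prod_right' (f := fun p : X × Z => (M.dens p.1 p.2 : ℝ≥0∞))
      (M.dens_meas.coe_nnreal_ennreal)

lemma transKernel_apply (x : X) : M.transKernel x = M.trans x := rfl

instance : IsMarkovKernel M.transKernel :=
  ⟨fun x => ⟨by simp [transKernel_apply, trans, M.dens_lintegral]⟩⟩

instance (x : X) : IsProbabilityMeasure (M.trans x) :=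
  inferInstanceAs (IsProbabilityMeasure (M.transKernel x))

lemma integral_trans (x : X) (φ : Z → ℝ) :
    ∫ z, φ z ∂M.trans x = ∫ z, (M.dens x z : ℝ) * φ z ∂M.ref := by
  rw [trans, integral_withDensity_eq_integral_smul (M.measurable_dens_right x)]
  rfl

lemma integrable_trans {x : X} {φ : Z → ℝ} (hφ : Measurable φ) {B : ℝ} (hB : ∀ z, |φ z| ≤ B) :
    Integrable φ (M.trans x) :=
  Integrable.of_bound hφ.aestronglyMeasurable B (ae_of_all _ hB)

lemma integrable_dens_mul {x : X} {φ : Z → ℝ} (hφ : Measurable φ) {B : ℝ} (hB : ∀ z, |φ z| ≤ B) :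
    Integrable (fun z => (M.dens x z : ℝ) * φ z) M.ref := by
  have := M.integrable_trans (x := x) hφ hB
  rw [trans, integrable_withDensity_iff_integrable_smul
    (M.measurable_dens_right x)] at this
  exact this

lemma measurable_integral_trans {φ : X → Z → ℝ} (hφ : Measurable (Function.uncurry φ)) :
    Measurable fun x => ∫ z, φ x z ∂M.trans x :=
  (hφ.stronglyMeasurable.integral_kernel_prod_right (κ := M.transKernel)).measurable

lemma abs_integral_trans_le {φ : Z → ℝ} {B : ℝ} (hB : ∀ z, |φ z| ≤ B) (x : X) :
    |∫ z, φ z ∂M.trans x| ≤ B := by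
  simpa using norm_integral_le_of_norm_le_const (μ := M.trans x) (f := φ) (C := B)
    (ae_of_all _ hB)

/-- The weights of particles at the positions `x`, given the observation `v`. -/
def normWeight (v : Y) {N : ℕ} (x : Fin N → X) (i : Fin N) : ℝ≥0 :=
  M.obs v (x i) / ∑ l, M.obs v (x l)

lemma measurable_normWeight (v : Y) {N : ℕ} (i : Fin N) :
    Measurable fun x : Fin N → X => M.normWeight v x i :=
  ((M.measurable_obs v).comp (measurable_pi_apply i)).div
    (Finset.measurable_sum _ fun l _ => (M.measurable_obs v).comp (measurable_pi_apply l))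

lemma sum_obs_pos (hg_pos : ∀ (v : Y) (x : X), 0 < M.obs v x) (v : Y) {N : ℕ} (hN : 1 ≤ N)
    (x : Fin N → X) : 0 < ∑ l, M.obs v (x l) :=
  Finset.sum_pos (fun l _ => hg_pos v (x l)) ⟨⟨0, hN⟩, Finset.mem_univ _⟩

lemma sum_normWeight (hg_pos : ∀ (v : Y) (x : X), 0 < M.obs v x) (v : Y) {N : ℕ} (hN : 1 ≤ N)
    (x : Fin N → X) : ∑ i, M.normWeight v x i = 1 := by
  simp only [normWeight]
  rw [← Finset.sum_div]
  exact div_self (M.sum_obs_pos hg_pos v hN x).ne'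

/-- The mixture of the transition laws from the positions `x`. -/
def mixture (v : Y) {N : ℕ} (x : Fin N → X) : Measure Z :=
  ∑ j, (M.normWeight v x j : ℝ≥0∞) • M.trans (x j)

lemma integral_mixture (v : Y) {N : ℕ} (x : Fin N → X) {φ : Z → ℝ} (hφ : Measurable φ) {B : ℝ}
    (hB : ∀ z, |φ z| ≤ B) :
    ∫ z, φ z ∂M.mixture v x = ∑ j, (M.normWeight v x j : ℝ) * ∫ z, φ z ∂M.trans (x j) := by
  rw [mixture, integral_finsetSum_measure]
  · simp only [integral_smul_measure, ENNReal.coe_toReal, smul_eq_mul]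
  · exact fun j _ => (M.integrable_trans hφ hB).smul_measure ENNReal.coe_ne_top

/-- The mixture as a kernel, from the positions and arbitrary further data. -/
def mixtureKernel (v : Y) (N : ℕ) (T : Type*) [MeasurableSpace T] : Kernel ((Fin N → X) × T) Z where
  toFun σ := M.mixture v σ.1
  measurable' := by
    refine Measure.measurable_of_measurable_coe _ fun A hA => ?_
    simp only [mixture, Measure.coe_finsetSum, Finset.sum_apply, Measure.smul_apply, smul_eq_mul]
    refine Finset.measurable_sum _ fun j _ => Measurable.mul ?_ ?_
    · exact ((M.measurable_normWeight v j).comp measurable_fst).coe_nnreal_ennreal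
    · exact (M.transKernel.measurable_coe hA).comp
        ((measurable_pi_apply j).comp measurable_fst)

lemma isMarkovKernel_mixtureKernel (hg_pos : ∀ (v : Y) (x : X), 0 < M.obs v x) (v : Y) {N : ℕ}
    (hN : 1 ≤ N) (T : Type*) [MeasurableSpace T] : IsMarkovKernel (M.mixtureKernel v N T) := by
  refine ⟨fun σ => ⟨?_⟩⟩
  change M.mixture v σ.1 Set.univ = 1
  simp only [mixture, Measure.coe_finsetSum, Finset.sum_apply, Measure.smul_apply, smul_eq_mul,
    measure_univ, mul_one]
  exact_mod_cast M.sum_normWeight hg_pos v hN σ.1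

/-- The weighted average `∑_j w_j p(z | x_j) (t_j + φ(x_j, z)) / ∑_l w_l p(z | x_l)`. -/
def backwardMean (φ : X → Z → ℝ) (v : Y) {N : ℕ} (x : Fin N → X) (t : Fin N → ℝ) (z : Z) : ℝ :=
  (∑ j, (M.normWeight v x j : ℝ) * M.dens (x j) z * (t j + φ (x j) z)) /
    ∑ l, (M.normWeight v x l : ℝ) * M.dens (x l) z

lemma measurable_backwardMean {φ : X → Z → ℝ} (hφ : Measurable (Function.uncurry φ)) (v : Y)
    {N : ℕ} : Measurable fun p : ((Fin N → X) × (Fin N → ℝ)) × Z =>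
      M.backwardMean φ v p.1.1 p.1.2 p.2 := by
  have hx : ∀ j, Measurable fun p : ((Fin N → X) × (Fin N → ℝ)) × Z => p.1.1 j := fun j =>
    (measurable_pi_apply j).comp (measurable_fst.comp measurable_fst)
  have ht : ∀ j, Measurable fun p : ((Fin N → X) × (Fin N → ℝ)) × Z => p.1.2 j := fun j =>
    (measurable_pi_apply j).comp (measurable_snd.comp measurable_fst)
  have hw : ∀ j, Measurable fun p : ((Fin N → X) × (Fin N → ℝ)) × Z =>
      (M.normWeight v p.1.1 j : ℝ) * M.dens (p.1.1 j) p.2 := fun j =>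
    (((M.measurable_normWeight v j).comp (measurable_fst.comp measurable_fst)).coe_nnreal_real).mul
      (M.measurable_dens (hx j) measurable_snd).coe_nnreal_real
  refine Measurable.div (Finset.measurable_sum _ fun j _ => (hw j).mul ((ht j).add ?_))
    (Finset.measurable_sum _ fun j _ => hw j)
  exact hφ.comp ((hx j).prodMk measurable_snd)

/-- A weighted average with nonnegative weights cannot exceed the bound on its terms. If the
denominator vanishes the quotient is `0`, which is why `0 ≤ B + C` is required. -/
lemma abs_backwardMean_le {φ : X → Z → ℝ} {C : ℝ} (hC : ∀ x z, |φ x z| ≤ C) (v : Y) {N : ℕ}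
    (x : Fin N → X) {t : Fin N → ℝ} {B : ℝ} (hB : ∀ j, |t j| ≤ B) (hBC : 0 ≤ B + C) (z : Z) :
    |M.backwardMean φ v x t z| ≤ B + C := by
  have hw : ∀ j, 0 ≤ (M.normWeight v x j : ℝ) * M.dens (x j) z := fun j => by positivity
  have h0 : 0 ≤ ∑ j, (M.normWeight v x j : ℝ) * M.dens (x j) z := Finset.sum_nonneg fun j _ => hw j
  rw [backwardMean, abs_div, abs_of_nonneg h0]
  refine div_le_of_le_mul₀ h0 hBC ?_
  rw [Finset.mul_sum]
  refine (Finset.abs_sum_le_sum_abs _ _).trans (Finset.sum_le_sum fun j _ => ?_)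
  rw [abs_mul, abs_of_nonneg (hw j), mul_comm]
  exact mul_le_mul_of_nonneg_right ((abs_add_le _ _).trans (add_le_add (hB j) (hC _ _))) (hw j)

/-- Valid even where the denominator is zero: its terms are nonnegative, so each of them vanishes
and the numerator does too. -/
lemma sum_mul_backwardMean (φ : X → Z → ℝ) (v : Y) {N : ℕ} (x : Fin N → X) (t : Fin N → ℝ)
    (z : Z) :
    (∑ l, (M.normWeight v x l : ℝ) * M.dens (x l) z) * M.backwardMean φ v x t z =
      ∑ j, (M.normWeight v x j : ℝ) * M.dens (x j) z * (t j + φ (x j) z) := by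
  by_cases h : ∑ l, (M.normWeight v x l : ℝ) * M.dens (x l) z = 0
  · have h' := (Finset.sum_eq_zero_iff_of_nonneg fun j _ => by positivity).1 h
    rw [h, zero_mul, Finset.sum_eq_zero]
    intro j hj
    rw [h' j hj, zero_mul]
  · rw [backwardMean, mul_div_cancel₀ _ h]

/-- Integrating a function of the backward mean against the mixture cancels its denominator. -/
lemma sum_integral_backwardMean (φ : X → Z → ℝ) (v : Y) {N : ℕ} (x : Fin N → X) (t : Fin N → ℝ)
    (f h : Z → ℝ) {B : ℝ}
    (hm₁ : Measurable fun z => f z * M.backwardMean φ v x t z + h z)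
    (hb₁ : ∀ z, |f z * M.backwardMean φ v x t z + h z| ≤ B)
    (hm₂ : ∀ j, Measurable fun z => f z * (t j + φ (x j) z) + h z)
    (hb₂ : ∀ j z, |f z * (t j + φ (x j) z) + h z| ≤ B) :
    ∫ z, (f z * M.backwardMean φ v x t z + h z) ∂M.mixture v x =
      ∑ j, (M.normWeight v x j : ℝ) * ∫ z, (f z * (t j + φ (x j) z) + h z) ∂M.trans (x j) := by
  rw [M.integral_mixture v x hm₁ hb₁]
  -- Both sides become integrals of finite sums against `ref`, and the integrands agree pointwise by
  -- `sum_mul_backwardMean`.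
  simp only [integral_trans, ← integral_const_mul]
  rw [← integral_finsetSum _ fun j _ => (M.integrable_dens_mul hm₁ hb₁).const_mul _,
    ← integral_finsetSum _ fun j _ => (M.integrable_dens_mul (hm₂ j) (hb₂ j)).const_mul _]
  congr 1 with z
  have := congrArg (f z * ·) (M.sum_mul_backwardMean φ v x t z)
  simp only [Finset.sum_mul, Finset.mul_sum] at this
  rw [← sub_eq_zero, ← Finset.sum_sub_distrib] at this ⊢
  rw [← this]
  exact Finset.sum_congr rfl fun j _ => by ring

lemma abs_mul_add_le {p q r P Q R : ℝ} (hp : |p| ≤ P) (hq : |q| ≤ Q) (hr : |r| ≤ R) :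
    |p * q + r| ≤ P * Q + R := by
  refine (abs_add_le _ _).trans (add_le_add ?_ hr)
  rw [abs_mul]
  exact mul_le_mul hp hq (abs_nonneg _) ((abs_nonneg _).trans hp)

/-- The stability of the class: the result is again affine in `t j`, with slope the integral of `f`,
while the increment `φ` is absorbed into the constant term. -/
lemma integral_mixture_backwardMean {φ : X → Z → ℝ} (hφ : Measurable (Function.uncurry φ)) {C : ℝ}
    (hC : ∀ x z, |φ x z| ≤ C) (v : Y) {N : ℕ} (x : Fin N → X) {t : Fin N → ℝ} {B : ℝ}
    (hB : ∀ j, |t j| ≤ B) (hBC : 0 ≤ B + C)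
    {f h : Z → ℝ} (hf : Measurable f) (hh : Measurable h) {F H : ℝ} (hF : ∀ z, |f z| ≤ F)
    (hH : ∀ z, |h z| ≤ H) :
    ∫ z, (f z * M.backwardMean φ v x t z + h z) ∂M.mixture v x =
      ∑ j, (M.normWeight v x j : ℝ) * ((∫ z, f z ∂M.trans (x j)) * t j +
        ∫ z, (f z * φ (x j) z + h z) ∂M.trans (x j)) := by
  have hφx : ∀ x, Measurable (φ x) := fun x => hφ.comp measurable_prodMk_left
  have hb : Measurable (M.backwardMean φ v x t) := by
    have := (M.measurable_backwardMean hφ v (N := N)).comp (measurable_prodMk_left (x := (x, t)))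
    simpa only [Function.comp_def] using this
  rw [M.sum_integral_backwardMean φ v x t f h (B := F * (B + C) + H) ((hf.mul hb).add hh)
    (fun z => abs_mul_add_le (hF z) (M.abs_backwardMean_le hC v x hB hBC z) (hH z))
    (fun j => (hf.mul ((hφx _).const_add _)).add hh)
    fun j z => abs_mul_add_le (hF z) ((abs_add_le _ _).trans (add_le_add (hB j) (hC _ z))) (hH z)]
  refine Finset.sum_congr rfl fun j _ => ?_
  congr 1
  rw [← integral_mul_const, ← integral_add]
  · congr 1 with z; ring
  · exact (M.integrable_trans hf hF).mul_const _
  · exact M.integrable_trans ((hf.mul (hφx _)).add hh)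
      fun z => abs_mul_add_le (hF z) (hC _ z) (hH z)

/-! ### The particle system -/

section System

variable (y : ℕ → Y) (s : AdditiveFunctional X Z)

lemma particle_congr {N : ℕ} (x₀ : Fin N → X) {z z' : ℕ → Fin N → Z} {k : ℕ}
    (h : ∀ j < k, z j = z' j) : M.particle x₀ z k = M.particle x₀ z' k := by
  cases k with
  | zero => rfl
  | succ k => funext i; simp only [particle, h k k.lt_succ_self]

/-- Adaptedness: quantities at time `k` read only the draws with index below `k`, the ones
`law_step` conditions on. -/
lemma functional_congr {N : ℕ} (x₀ : Fin N → X) {z z' : ℕ → Fin N → Z} {k : ℕ}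
    (h : ∀ j < k, z j = z' j) : M.functional y s x₀ z k = M.functional y s x₀ z' k := by
  induction k with
  | zero => rfl
  | succ k ih =>
    have h' : ∀ j < k, z j = z' j := fun j hj => h j (hj.trans k.lt_succ_self)
    funext i
    simp only [functional, weight, ih h', M.particle_congr x₀ h', h k k.lt_succ_self]

lemma functional_succ {N : ℕ} (x₀ : Fin N → X) (z : ℕ → Fin N → Z) (k : ℕ) (i : Fin N) :
    M.functional y s x₀ z (k + 1) i =
      M.backwardMean (s.step k) (y k) (M.particle x₀ z k) (M.functional y s x₀ z k) (z k i) := rfl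

lemma measurable_particle {N : ℕ} (k : ℕ) :
    Measurable fun p : (Fin N → X) × (ℕ → Fin N → Z) => M.particle p.1 p.2 k := by
  cases k with
  | zero => exact measurable_fst
  | succ k =>
    refine measurable_pi_lambda _ fun i => M.endpoint_meas.comp ?_
    exact (measurable_pi_apply i).comp ((measurable_pi_apply k).comp measurable_snd)

lemma measurable_functional {N : ℕ} (k : ℕ) :
    Measurable fun p : (Fin N → X) × (ℕ → Fin N → Z) => M.functional y s p.1 p.2 k := by
  induction k with
  | zero =>
    exact measurable_pi_lambda _ fun i => s.init_meas.comp ((measurable_pi_apply i).comp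
      measurable_fst)
  | succ k ih =>
    refine measurable_pi_lambda _ fun i => ?_
    simp only [functional_succ]
    have hp : Measurable fun p : (Fin N → X) × (ℕ → Fin N → Z) =>
        ((M.particle p.1 p.2 k, M.functional y s p.1 p.2 k), p.2 k i) :=
      ((M.measurable_particle k).prodMk ih).prodMk
        ((measurable_pi_apply i).comp ((measurable_pi_apply k).comp measurable_snd))
    have := (M.measurable_backwardMean (s.step_meas k) (y k) (N := N)).comp hp
    simpa only [Function.comp_def] using this

/-- The bound is independent of `N` and of the particles, which makes the Hoeffding constants
uniform. -/
lemma exists_abs_functional_le {s : AdditiveFunctional X Z} (hs : s.IsBounded) (k : ℕ) :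
    ∃ B : ℝ, 0 ≤ B ∧ ∀ (N : ℕ) (x₀ : Fin N → X) (z : ℕ → Fin N → Z) (i : Fin N),
      |M.functional y s x₀ z k i| ≤ B := by
  induction k with
  | zero =>
    obtain ⟨C, hC⟩ := hs.1
    exact ⟨max C 0, le_max_right _ _, fun N x₀ z i => (hC _).trans (le_max_left _ _)⟩
  | succ k ih =>
    obtain ⟨B, hB0, hB⟩ := ih
    obtain ⟨C, hC⟩ := hs.2 k
    have hC' : ∀ x z, |s.step k x z| ≤ max C 0 := fun x z => (hC x z).trans (le_max_left _ _)
    have h0 : 0 ≤ B + max C 0 := add_nonneg hB0 (le_max_right _ _)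
    refine ⟨B + max C 0, h0, fun N x₀ z i => ?_⟩
    rw [functional_succ]
    exact M.abs_backwardMean_le hC' _ _ (hB N x₀ z) h0 _

/-- Given the current particles and functionals, the next particles are independent draws from
the mixture. -/
lemma IsParticleSystem.law_next {M : Model X Z Y} {y : ℕ → Y} {Ω : Type*} [MeasurableSpace Ω]
    {P : Measure Ω} {N : ℕ} {x₀ : Ω → Fin N → X} {z : Ω → ℕ → Fin N → Z}
    (h : M.IsParticleSystem y P x₀ z) (k : ℕ) (C : Set ((Fin N → X) × (Fin N → ℝ)))
    (A : Fin N → Set Z) (hC : MeasurableSet C) (hA : ∀ i, MeasurableSet (A i)) :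
    P {ω | (M.particle (x₀ ω) (z ω) k, M.functional y s (x₀ ω) (z ω) k) ∈ C ∧
        ∀ i, z ω k i ∈ A i} =
      ∫⁻ ω in (fun ω => (M.particle (x₀ ω) (z ω) k, M.functional y s (x₀ ω) (z ω) k)) ⁻¹' C,
        ∏ i, M.mixture (y k) (M.particle (x₀ ω) (z ω) k) (A i) ∂P := by
  obtain ⟨z₀⟩ := M.nonempty_augmented
  -- The padding value `z₀` is irrelevant by adaptedness; it only lets the time-`k` quantities be
  -- written as a measurable function `Φ` of the finite history.
  let ext : (Fin k → Fin N → Z) → ℕ → Fin N → Z := fun w j => if hj : j < k then w ⟨j, hj⟩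
    else fun _ => z₀
  have hext : Measurable ext := by
    refine measurable_pi_lambda _ fun j => ?_
    by_cases hj : j < k
    · simpa only [ext, hj, dif_pos] using measurable_pi_apply _
    · simpa only [ext, hj, dif_neg, not_false_eq_true] using measurable_const
  let Φ : (Fin N → X) × (Fin k → Fin N → Z) → (Fin N → X) × (Fin N → ℝ) := fun p =>
    (M.particle p.1 (ext p.2) k, M.functional y s p.1 (ext p.2) k)
  have hΦ : Measurable Φ := by
    have he : Measurable fun p : (Fin N → X) × (Fin k → Fin N → Z) => (p.1, ext p.2) :=
      measurable_fst.prodMk (hext.comp measurable_snd)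
    exact ((M.measurable_particle k).comp he).prodMk ((M.measurable_functional y s k).comp he)
  have heq : ∀ ω, (M.particle (x₀ ω) (z ω) k, M.functional y s (x₀ ω) (z ω) k) =
      Φ (x₀ ω, fun j : Fin k => z ω j) := by
    intro ω
    have : ∀ j < k, z ω j = ext (fun j : Fin k => z ω j) j := fun j hj => by simp [ext, hj]
    simp only [Φ, ← M.particle_congr (x₀ ω) this, ← M.functional_congr y s (x₀ ω) this]
  have := h.law_step k (Φ ⁻¹' C) A (hΦ hC) hA
  simp only [Set.mem_preimage, ← heq] at this
  exact this

end System

end Model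

end PathspaceSmoothing

namespace PathspaceSmoothing

open ProbabilityTheory

namespace Model

variable {X Z Y : Type*} [MeasurableSpace X] [MeasurableSpace Z] [MeasurableSpace Y]
variable (M : Model X Z Y)

/-! ### Recursion for the law of the augmented path -/

/-- Append one augmented variable to a path. -/
def appendPath {n : ℕ} (p : (X × (Fin n → Z)) × Z) : X × (Fin (n + 1) → Z) :=
  (p.1.1, Fin.snoc (α := fun _ => Z) p.1.2 p.2)

lemma measurable_appendPath {n : ℕ} : Measurable (appendPath (X := X) (Z := Z) (n := n)) := by
  refine (measurable_fst.comp measurable_fst).prodMk (measurable_pi_lambda _ fun i => ?_)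
  refine Fin.lastCases ?_ (fun i => ?_) i
  · simpa only [Fin.snoc_last] using measurable_snd
  · simp only [Fin.snoc_castSucc]
    exact (measurable_pi_apply i).comp (measurable_snd.comp measurable_fst)

lemma states_appendPath {n : ℕ} (p : (X × (Fin n → Z)) × Z) :
    M.states (appendPath p) = Fin.snoc (α := fun _ => X) (M.states p.1) (M.endpoint p.2) := by
  have h := Fin.comp_snoc (α := Z) M.endpoint p.1.2 p.2
  change Fin.cons (α := fun _ => X) p.1.1
    (M.endpoint ∘ Fin.snoc (α := fun _ => Z) p.1.2 p.2) = _
  rw [h, Fin.cons_snoc_eq_snoc_cons]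
  rfl

lemma states_appendPath_castSucc {n : ℕ} (p : (X × (Fin n → Z)) × Z) (k : Fin (n + 1)) :
    M.states (appendPath p) k.castSucc = M.states p.1 k := by
  rw [states_appendPath, Fin.snoc_castSucc]

lemma states_appendPath_last {n : ℕ} (p : (X × (Fin n → Z)) × Z) :
    M.states (appendPath p) (Fin.last (n + 1)) = M.endpoint p.2 := by
  rw [states_appendPath, Fin.snoc_last]

lemma likelihood_appendPath (y : ℕ → Y) {n : ℕ} (p : (X × (Fin n → Z)) × Z) :
    M.likelihood y (appendPath p) = M.likelihood y p.1 * M.obs (y (n + 1)) (M.endpoint p.2) := by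
  rw [likelihood, Fin.prod_univ_castSucc, states_appendPath_last]
  simp only [states_appendPath_castSucc]
  rfl

lemma pathValue_appendPath (s : AdditiveFunctional X Z) {n : ℕ} (p : (X × (Fin n → Z)) × Z) :
    M.pathValue s (appendPath p) =
      M.pathValue s p.1 + s.step n (M.states p.1 (Fin.last n)) p.2 := by
  rw [pathValue, Fin.sum_univ_castSucc, ← add_assoc]
  simp only [states_appendPath_castSucc]
  simp [pathValue, appendPath]

lemma measurable_states {n : ℕ} (k : Fin (n + 1)) :
    Measurable fun w : X × (Fin n → Z) => M.states w k := by
  refine Fin.cases ?_ (fun i => ?_) k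
  · exact measurable_fst
  · exact M.endpoint_meas.comp ((measurable_pi_apply i).comp measurable_snd)

lemma measurable_likelihood (y : ℕ → Y) (n : ℕ) : Measurable (M.likelihood y (n := n)) :=
  Finset.measurable_prod _ fun k _ =>
    ((M.measurable_obs (y k)).comp (M.measurable_states k)).coe_nnreal_ennreal

lemma measurable_pathValue (s : AdditiveFunctional X Z) (n : ℕ) :
    Measurable (M.pathValue s (n := n)) :=
  (s.init_meas.comp measurable_fst).add <| Finset.measurable_sum _ fun k _ =>
    (s.step_meas k).comp (f := fun w : X × (Fin n → Z) => (M.states w k.castSucc, w.2 k))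
      ((M.measurable_states _).prodMk ((measurable_pi_apply k).comp measurable_snd))

lemma exists_abs_pathValue_le {s : AdditiveFunctional X Z} (hs : s.IsBounded) (n : ℕ) :
    ∃ B : ℝ, ∀ w : X × (Fin n → Z), |M.pathValue s w| ≤ B := by
  obtain ⟨C₀, hC₀⟩ := hs.1
  choose C hC using hs.2
  exact ⟨C₀ + ∑ k : Fin n, C k, fun w => (abs_add_le _ _).trans (add_le_add (hC₀ _)
    ((Finset.abs_sum_le_sum_abs _ _).trans (Finset.sum_le_sum fun k _ => hC _ _ _)))⟩

lemma exists_likelihood_le {y : ℕ → Y} (hg : ∀ v : Y, ∃ C : ℝ≥0, ∀ x : X, M.obs v x ≤ C) (n : ℕ) :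
    ∃ C : ℝ≥0, ∀ w : X × (Fin n → Z), M.likelihood y w ≤ C := by
  choose C hC using hg
  refine ⟨∏ k : Fin (n + 1), C (y k), fun w => ?_⟩
  rw [ENNReal.ofNNReal_finsetProd]
  exact Finset.prod_le_prod' fun k _ => ENNReal.coe_le_coe.2 (hC _ _)

lemma likelihood_pos (hg_pos : ∀ (v : Y) (x : X), 0 < M.obs v x) (y : ℕ → Y) {n : ℕ}
    (w : X × (Fin n → Z)) : 0 < M.likelihood y w := by
  rw [likelihood, pos_iff_ne_zero, Finset.prod_ne_zero_iff]
  exact fun k _ => ENNReal.coe_ne_zero.2 (hg_pos _ _).ne'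

lemma signalLaw_zero : M.signalLaw 0 = M.init.map fun x => (x, Fin.elim0) := by
  have := M.init_prob
  have hd : (Measure.pi fun _ : Fin 0 => M.ref) = Measure.dirac Fin.elim0 :=
    Measure.pi_of_empty _ _
  simp only [signalLaw, Finset.univ_eq_empty, Finset.prod_empty]
  rw [hd, Measure.prod_dirac]
  exact withDensity_one

lemma measurable_signalDensity (n : ℕ) : Measurable fun h : X × (Fin n → Z) =>
    ∏ k : Fin n, (M.dens (M.states h k.castSucc) (h.2 k) : ℝ≥0∞) :=
  Finset.measurable_prod _ fun k _ => (M.measurable_dens (M.measurable_states _)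
    ((measurable_pi_apply k).comp measurable_snd)).coe_nnreal_ennreal

/-- The kernel that moves from the last state of a path. -/
def pathKernel (n : ℕ) : Kernel (X × (Fin n → Z)) Z :=
  M.transKernel.comap (fun w => M.states w (Fin.last n)) (M.measurable_states _)

instance (n : ℕ) : IsMarkovKernel (M.pathKernel n) := by
  unfold pathKernel; infer_instance

lemma pathKernel_apply {n : ℕ} (w : X × (Fin n → Z)) :
    M.pathKernel n w = M.trans (M.states w (Fin.last n)) := rfl

instance (n : ℕ) : SFinite (M.signalLaw n) := by
  have := M.init_prob
  have := M.ref_sigmaFinite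
  unfold signalLaw; infer_instance

lemma lintegral_ref_snoc {n : ℕ} {φ : (Fin (n + 1) → Z) → ℝ≥0∞} (hφ : Measurable φ) :
    ∫⁻ w, φ w ∂(Measure.pi fun _ : Fin (n + 1) => M.ref) =
      ∫⁻ w, ∫⁻ z, φ (Fin.snoc (α := fun _ => Z) w z) ∂M.ref
        ∂(Measure.pi fun _ : Fin n => M.ref) := by
  have := M.ref_sigmaFinite
  have hmp := (measurePreserving_piFinSuccAbove (fun _ : Fin (n + 1) => M.ref)
    (Fin.last n)).symm
  rw [← hmp.lintegral_comp hφ, lintegral_prod_symm' (fun p => φ (_)) (hφ.comp hmp.measurable)]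
  simp [MeasurableEquiv.piFinSuccAbove_symm_apply, Fin.insertNthEquiv, Fin.insertNth_last']

/-- The last factor of the product density is the density of `pathKernel`, and the earlier factors
see only the truncated path; Tonelli then separates the last coordinate. -/
lemma signalLaw_succ (n : ℕ) :
    M.signalLaw (n + 1) = (M.signalLaw n ⊗ₘ M.pathKernel n).map appendPath := by
  have := M.init_prob
  have := M.ref_sigmaFinite
  refine Measure.ext_of_lintegral _ fun φ hφ => ?_
  have hφ' : Measurable fun p : (X × (Fin n → Z)) × Z => φ (appendPath p) :=
    hφ.comp measurable_appendPath
  have hd := M.measurable_signalDensity (n + 1)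
  have hin : Measurable fun w : X × (Fin n → Z) => ∫⁻ z, φ (appendPath (w, z)) ∂M.pathKernel n w :=
    hφ'.lintegral_kernel_prod_right'
  rw [lintegral_map hφ measurable_appendPath, Measure.lintegral_compProd hφ', signalLaw, signalLaw,
    lintegral_withDensity_eq_lintegral_mul _ hd hφ,
    lintegral_withDensity_eq_lintegral_mul _ (M.measurable_signalDensity n) hin,
    lintegral_prod _ (hd.mul hφ).aemeasurable,
    lintegral_prod _ ((M.measurable_signalDensity n).mul hin).aemeasurable]
  refine lintegral_congr fun x => ?_
  have hx : Measurable fun w => ((fun h : X × (Fin (n + 1) → Z) =>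
      ∏ k : Fin (n + 1), (M.dens (M.states h k.castSucc) (h.2 k) : ℝ≥0∞)) * φ) (x, w) :=
    (hd.mul hφ).comp measurable_prodMk_left
  rw [M.lintegral_ref_snoc hx]
  refine lintegral_congr fun w => ?_
  have hz : Measurable fun z => φ (appendPath ((x, w), z)) := hφ'.comp measurable_prodMk_left
  have hdz := (M.measurable_dens_right (M.states (x, w) (Fin.last n))).coe_nnreal_ennreal
  simp only [Pi.mul_apply, pathKernel_apply, trans]
  rw [lintegral_withDensity_eq_lintegral_mul _ hdz hz, ← lintegral_const_mul _ (hdz.mul hz)]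
  refine lintegral_congr fun z => ?_
  have h1 : ∀ k, M.states (x, Fin.snoc (α := fun _ => Z) w z) (Fin.castSucc k) =
    M.states (x, w) k := M.states_appendPath_castSucc ((x, w), z)
  rw [Fin.prod_univ_castSucc]
  simp only [h1, Fin.snoc_castSucc, Fin.snoc_last, Pi.mul_apply]
  rw [mul_assoc]
  rfl

lemma isProbabilityMeasure_signalLaw (n : ℕ) : IsProbabilityMeasure (M.signalLaw n) := by
  induction n with
  | zero =>
    have := M.init_prob
    rw [signalLaw_zero]
    exact Measure.isProbabilityMeasure_map (by fun_prop)
  | succ n ih =>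
    rw [signalLaw_succ]
    exact Measure.isProbabilityMeasure_map measurable_appendPath.aemeasurable

/-! ### The unnormalised smoothing functional -/

/-- The integral of `f(x_n) S(𝐱_{0:n}) + h(x_n)` against the unnormalised smoothing law. -/
def unnormalized (y : ℕ → Y) (s : AdditiveFunctional X Z) (n : ℕ) (f h : X → ℝ) : ℝ :=
  ∫ w, (M.likelihood y w).toReal * (f (M.states w (Fin.last n)) * M.pathValue s w +
    h (M.states w (Fin.last n))) ∂M.signalLaw n

variable {y : ℕ → Y} {s : AdditiveFunctional X Z}

lemma unnormalized_zero {f h : X → ℝ} (hf : Measurable f) (hh : Measurable h) :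
    M.unnormalized y s 0 f h = ∫ x, (M.obs (y 0) x : ℝ) * (f x * s.init x + h x) ∂M.init := by
  rw [unnormalized, signalLaw_zero, integral_map (by fun_prop)]
  · simp [likelihood, pathValue, states]
  · refine Measurable.aestronglyMeasurable ?_
    exact (M.measurable_likelihood y 0).ennreal_toReal.mul (((hf.comp (M.measurable_states _)).mul
      (M.measurable_pathValue s 0)).add (hh.comp (M.measurable_states _)))

lemma measurable_unnormalized_integrand (n : ℕ) {f h : X → ℝ} (hf : Measurable f)
    (hh : Measurable h) : Measurable fun w : X × (Fin n → Z) =>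
      (M.likelihood y w).toReal * (f (M.states w (Fin.last n)) * M.pathValue s w +
        h (M.states w (Fin.last n))) :=
  (M.measurable_likelihood y n).ennreal_toReal.mul (((hf.comp (M.measurable_states _)).mul
    (M.measurable_pathValue s n)).add (hh.comp (M.measurable_states _)))

lemma exists_abs_unnormalized_integrand_le (hg : ∀ v : Y, ∃ C : ℝ≥0, ∀ x : X, M.obs v x ≤ C)
    (hs : s.IsBounded) (n : ℕ) {f h : X → ℝ} {F H : ℝ} (hF : ∀ x, |f x| ≤ F)
    (hH : ∀ x, |h x| ≤ H) : ∃ B : ℝ, ∀ w : X × (Fin n → Z),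
      |(M.likelihood y w).toReal * (f (M.states w (Fin.last n)) * M.pathValue s w +
        h (M.states w (Fin.last n)))| ≤ B := by
  obtain ⟨C, hC⟩ := M.exists_likelihood_le (y := y) hg n
  obtain ⟨B, hB⟩ := M.exists_abs_pathValue_le hs n
  refine ⟨C * (F * B + H), fun w => ?_⟩
  rw [abs_mul, abs_of_nonneg ENNReal.toReal_nonneg]
  exact mul_le_mul (ENNReal.toReal_mono ENNReal.coe_ne_top (hC w))
    (abs_mul_add_le (hF _) (hB w) (hH _)) (abs_nonneg _) C.2

/-- Integrating out the last augmented variable given the earlier path: the old path value keeps the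
coefficient `f'`, and the new increment, multiplied by `g f`, moves into the `h` slot. -/
lemma unnormalized_succ (hg : ∀ v : Y, ∃ C : ℝ≥0, ∀ x : X, M.obs v x ≤ C)
    (hs : s.IsBounded) (n : ℕ) {f h : X → ℝ} (hf : Measurable f) (hh : Measurable h)
    {F H : ℝ} (hF : ∀ x, |f x| ≤ F) (hH : ∀ x, |h x| ≤ H) :
    M.unnormalized y s (n + 1) f h = M.unnormalized y s n
      (fun x => ∫ z, (M.obs (y (n + 1)) (M.endpoint z) : ℝ) * f (M.endpoint z) ∂M.trans x)
      (fun x => ∫ z, ((M.obs (y (n + 1)) (M.endpoint z) : ℝ) * f (M.endpoint z) * s.step n x z +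
        (M.obs (y (n + 1)) (M.endpoint z) : ℝ) * h (M.endpoint z)) ∂M.trans x) := by
  have := M.isProbabilityMeasure_signalLaw n
  have hm := M.measurable_unnormalized_integrand (y := y) (s := s) (n + 1) hf hh
  obtain ⟨B, hB⟩ := M.exists_abs_unnormalized_integrand_le (y := y) hg hs (n + 1) hF hH
  obtain ⟨G, hG⟩ := hg (y (n + 1))
  obtain ⟨D, hD⟩ := hs.2 n
  have hG' : ∀ x, |(M.obs (y (n + 1)) x : ℝ)| ≤ G := fun x => by
    rw [abs_of_nonneg (NNReal.coe_nonneg _)]; exact_mod_cast hG x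
  have hmul : ∀ {p : ℝ} {P : ℝ} (x : X), |p| ≤ P →
      |(M.obs (y (n + 1)) x : ℝ) * p| ≤ G * P := fun x hp => by
    rw [abs_mul]; exact mul_le_mul (hG' x) hp (abs_nonneg _) G.2
  have hgm : Measurable fun z => (M.obs (y (n + 1)) (M.endpoint z) : ℝ) :=
    ((M.measurable_obs _).comp M.endpoint_meas).coe_nnreal_real
  have hfm := hgm.mul (hf.comp M.endpoint_meas)
  have hhm := hgm.mul (hh.comp M.endpoint_meas)
  rw [unnormalized, unnormalized, signalLaw_succ, integral_map measurable_appendPath.aemeasurable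
    hm.aestronglyMeasurable, Measure.integral_compProd]
  · refine integral_congr_ae (ae_of_all _ fun w => ?_)
    simp only [likelihood_appendPath, pathValue_appendPath, states_appendPath_last,
      pathKernel_apply, ENNReal.toReal_mul, ENNReal.coe_toReal]
    rw [← integral_mul_const, ← integral_add, ← integral_const_mul]
    · congr 1 with z; ring
    · exact (M.integrable_trans hfm fun z => hmul _ (hF _)).mul_const _
    · exact M.integrable_trans ((hfm.mul ((s.step_meas n).comp measurable_prodMk_left)).add hhm)
        fun z => abs_mul_add_le (hmul _ (hF _)) (hD _ _) (hmul _ (hH _))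
  · exact Integrable.of_bound (hm.comp measurable_appendPath).aestronglyMeasurable B
      (ae_of_all _ fun p => hB _)

/-- With `f = 0`, `h = 1` the functional is the normalising constant of Bayes' formula. -/
lemma unnormalized_one_pos (hg_pos : ∀ (v : Y) (x : X), 0 < M.obs v x)
    (hg : ∀ v : Y, ∃ C : ℝ≥0, ∀ x : X, M.obs v x ≤ C) (n : ℕ) :
    0 < M.unnormalized y s n (fun _ => 0) (fun _ => 1) := by
  have := M.isProbabilityMeasure_signalLaw n
  obtain ⟨C, hC⟩ := M.exists_likelihood_le (y := y) hg n
  have hpos : ∀ w : X × (Fin n → Z), 0 < (M.likelihood y w).toReal := fun w =>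
    ENNReal.toReal_pos (M.likelihood_pos hg_pos y w).ne' ((hC w).trans_lt ENNReal.coe_lt_top).ne
  simp only [unnormalized, zero_mul, zero_add, mul_one]
  rw [integral_pos_iff_support_of_nonneg (fun w => (hpos w).le)]
  · have : (Function.support fun w : X × (Fin n → Z) => (M.likelihood y w).toReal) = Set.univ :=
      Set.eq_univ_of_forall fun w => (hpos w).ne'
    rw [this]; simp
  · refine Integrable.of_bound (M.measurable_likelihood y n).ennreal_toReal.aestronglyMeasurable C
      (ae_of_all _ fun w => ?_)
    rw [Real.norm_eq_abs, abs_of_nonneg (hpos w).le]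
    exact ENNReal.toReal_mono ENNReal.coe_ne_top (hC w)

lemma smoothingExpectation_eq (hg : ∀ v : Y, ∃ C : ℝ≥0, ∀ x : X, M.obs v x ≤ C) (n : ℕ) :
    M.smoothingExpectation y s n = M.unnormalized y s n (fun _ => 1) (fun _ => 0) /
      M.unnormalized y s n (fun _ => 0) (fun _ => 1) := by
  obtain ⟨C, hC⟩ := M.exists_likelihood_le (y := y) hg n
  have htop : ∀ᵐ w ∂M.signalLaw n, M.likelihood y w < ∞ :=
    ae_of_all _ fun w => (hC w).trans_lt ENNReal.coe_lt_top
  rw [smoothingExpectation, smoothingLaw, integral_smul_measure,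
    integral_withDensity_eq_integral_toReal_smul (M.measurable_likelihood y n) htop]
  simp only [unnormalized, zero_mul, zero_add, mul_one, one_mul, add_zero, smul_eq_mul]
  rw [integral_toReal (M.measurable_likelihood y n).aemeasurable htop, ENNReal.toReal_inv,
    inv_mul_eq_div]

end Model

end PathspaceSmoothing

universe w

namespace PathspaceSmoothing

open ProbabilityTheory

namespace Model

variable {X Z Y : Type*} [MeasurableSpace X] [MeasurableSpace Z] [MeasurableSpace Y]
variable (M : Model X Z Y)

/-! ### Concentration of the particle approximations -/

/-- A statistic of the particle system deviates from zero by more than `ε` with probability at most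
`b exp(-c N ε²)`, uniformly over all particle systems. -/
def Concentrates (y : ℕ → Y) (V : ∀ N : ℕ, (Fin N → X) → (ℕ → Fin N → Z) → ℝ) : Prop :=
  ∃ b : ℝ, 0 < b ∧ ∃ c : ℝ, 0 < c ∧
    ∀ (Ω : Type*) [MeasurableSpace Ω] (P : Measure Ω) [IsProbabilityMeasure P]
      (N : ℕ) (x₀ : Ω → Fin N → X) (z : Ω → ℕ → Fin N → Z),
      1 ≤ N → M.IsParticleSystem y P x₀ z → ∀ ε : ℝ, 0 < ε →
        P.real {ω | ε < |V N (x₀ ω) (z ω)|} ≤ b * Real.exp (-c * N * ε ^ 2)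

variable {M} {y : ℕ → Y} {s : AdditiveFunctional X Z}

/-- Union bound: if `|V| > ε`, then `V₁` or `V₂` exceeds `ε / (2K)`, whence the factor `4K²` in the
rate. -/
lemma Concentrates.of_abs_le {V V₁ V₂ : ∀ N : ℕ, (Fin N → X) → (ℕ → Fin N → Z) → ℝ}
    (h₁ : Concentrates.{_, _, _, w} M y V₁) (h₂ : Concentrates.{_, _, _, w} M y V₂) {K : ℝ}
    (hK : 0 < K)
    (hV : ∀ N, 1 ≤ N → ∀ x₀ z, |V N x₀ z| ≤ K * (|V₁ N x₀ z| + |V₂ N x₀ z|)) :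
    Concentrates.{_, _, _, w} M y V := by
  obtain ⟨b₁, hb₁, c₁, hc₁, h₁⟩ := h₁
  obtain ⟨b₂, hb₂, c₂, hc₂, h₂⟩ := h₂
  refine ⟨b₁ + b₂, by positivity, min c₁ c₂ / (4 * K ^ 2),
    div_pos (lt_min hc₁ hc₂) (by positivity), fun Ω _ P _ N x₀ z hN hsys ε hε => ?_⟩
  have hε' : 0 < ε / (2 * K) := by positivity
  have hsub : {ω | ε < |V N (x₀ ω) (z ω)|} ⊆ {ω | ε / (2 * K) < |V₁ N (x₀ ω) (z ω)|} ∪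
      {ω | ε / (2 * K) < |V₂ N (x₀ ω) (z ω)|} := by
    intro ω hω
    by_contra hcon
    simp only [Set.mem_union, Set.mem_ofPred_eq, not_or, not_lt] at hcon hω
    have h3 := hV N hN (x₀ ω) (z ω)
    have h4 : K * (|V₁ N (x₀ ω) (z ω)| + |V₂ N (x₀ ω) (z ω)|) ≤
        K * (ε / (2 * K) + ε / (2 * K)) := by gcongr <;> tauto
    have h5 : K * (ε / (2 * K) + ε / (2 * K)) = ε := by field_simp; ring
    linarith
  have hexp : ∀ c, min c₁ c₂ ≤ c → Real.exp (-c * N * (ε / (2 * K)) ^ 2) ≤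
      Real.exp (-(min c₁ c₂ / (4 * K ^ 2)) * N * ε ^ 2) := by
    intro c hc
    rw [Real.exp_le_exp]
    have : -(min c₁ c₂ / (4 * K ^ 2)) * N * ε ^ 2 = -min c₁ c₂ * N * (ε / (2 * K)) ^ 2 := by
      field_simp; ring
    rw [this]
    gcongr
  calc _ ≤ _ := measureReal_mono hsub
    _ ≤ _ := measureReal_union_le _ _
    _ ≤ _ := add_le_add (h₁ Ω P N x₀ z hN hsys _ hε') (h₂ Ω P N x₀ z hN hsys _ hε')
    _ ≤ b₁ * _ + b₂ * _ := add_le_add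
        (mul_le_mul_of_nonneg_left (hexp c₁ (min_le_left _ _)) hb₁.le)
        (mul_le_mul_of_nonneg_left (hexp c₂ (min_le_right _ _)) hb₂.le)
    _ = _ := by ring

variable (M y s)

/-- The empirical mean of `g(y_n | x_n) (f(x_n) T̂_n + h(x_n))`. -/
def unnormalizedMean (n : ℕ) (f h : X → ℝ) (N : ℕ) (x₀ : Fin N → X) (z : ℕ → Fin N → Z) : ℝ :=
  (∑ i, (M.obs (y n) (M.particle x₀ z n i) : ℝ) * (f (M.particle x₀ z n i) *
    M.functional y s x₀ z n i + h (M.particle x₀ z n i))) / N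

/-- The weighted mean of `f(x_n) T̂_n + h(x_n)`. -/
def weightedMean (n : ℕ) (f h : X → ℝ) (N : ℕ) (x₀ : Fin N → X) (z : ℕ → Fin N → Z) : ℝ :=
  ∑ i, (M.weight y x₀ z n i : ℝ) * (f (M.particle x₀ z n i) *
    M.functional y s x₀ z n i + h (M.particle x₀ z n i))

variable {M}

lemma weightedMean_mul (hg_pos : ∀ (v : Y) (x : X), 0 < M.obs v x) (n : ℕ) (f h : X → ℝ) {N : ℕ}
    (hN : 1 ≤ N) (x₀ : Fin N → X) (z : ℕ → Fin N → Z) :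
    M.weightedMean y s n f h N x₀ z *
        M.unnormalizedMean y s n (fun _ => 0) (fun _ => 1) N x₀ z =
      M.unnormalizedMean y s n f h N x₀ z := by
  have hpos := M.sum_obs_pos hg_pos (y n) hN (M.particle x₀ z n)
  have hpos' : (0 : ℝ) < ∑ l, (M.obs (y n) (M.particle x₀ z n l) : ℝ) := by exact_mod_cast hpos
  simp only [weightedMean, unnormalizedMean, weight, zero_mul, zero_add, mul_one, NNReal.coe_div,
    NNReal.coe_sum]
  rw [← mul_div_assoc, Finset.sum_mul]
  congr 1
  refine Finset.sum_congr rfl fun i _ => ?_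
  field_simp

lemma abs_weightedMean_le (hg_pos : ∀ (v : Y) (x : X), 0 < M.obs v x) (n : ℕ) {f h : X → ℝ}
    {F H B : ℝ} (hF : ∀ x, |f x| ≤ F) (hH : ∀ x, |h x| ≤ H) {N : ℕ} (hN : 1 ≤ N) (x₀ : Fin N → X)
    (z : ℕ → Fin N → Z) (hB : ∀ i, |M.functional y s x₀ z n i| ≤ B) :
    |M.weightedMean y s n f h N x₀ z| ≤ F * B + H := by
  have h1 : ∑ i, (M.weight y x₀ z n i : ℝ) = 1 := by
    exact_mod_cast M.sum_normWeight hg_pos (y n) hN (M.particle x₀ z n)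
  rw [← one_mul (F * B + H), ← h1, Finset.sum_mul]
  refine (Finset.abs_sum_le_sum_abs _ _).trans (Finset.sum_le_sum fun i _ => ?_)
  rw [abs_mul, abs_of_nonneg (NNReal.coe_nonneg _)]
  exact mul_le_mul_of_nonneg_left (abs_mul_add_le (hF _) (hB i) (hH _)) (NNReal.coe_nonneg _)

variable {y s}

lemma concentrates_unnormalizedMean_zero (hs : s.IsBounded)
    (hg : ∀ v : Y, ∃ C : ℝ≥0, ∀ x : X, M.obs v x ≤ C) {f h : X → ℝ} (hf : Measurable f)
    (hh : Measurable h) {F H : ℝ} (hF : ∀ x, |f x| ≤ F) (hH : ∀ x, |h x| ≤ H) :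
    Concentrates.{_, _, _, w} M y fun N x₀ z =>
      M.unnormalizedMean y s 0 f h N x₀ z - M.unnormalized y s 0 f h := by
  obtain ⟨G, hG⟩ := hg (y 0)
  obtain ⟨C, hC⟩ := hs.1
  let a : X → ℝ := fun x => (M.obs (y 0) x : ℝ) * (f x * s.init x + h x)
  have ha : Measurable a :=
    (M.measurable_obs _).coe_nnreal_real.mul ((hf.mul s.init_meas).add hh)
  have haB : ∀ x, |a x| ≤ |G * (F * C + H)| + 1 := by
    intro x
    refine le_trans ?_ ((le_abs_self (G * (F * C + H))).trans (le_add_of_nonneg_right zero_le_one))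
    rw [abs_mul, abs_of_nonneg (NNReal.coe_nonneg _)]
    exact mul_le_mul (by exact_mod_cast hG x) (abs_mul_add_le (hF x) (hC x) (hH x))
      (abs_nonneg _) G.2
  have hB : 0 < |G * (F * C + H)| + 1 := by positivity
  refine ⟨2, two_pos, 1 / (2 * (|G * (F * C + H)| + 1) ^ 2), by positivity,
    fun Ω _ P _ N x₀ z hN hsys ε hε => ?_⟩
  have := M.init_prob
  have hD : MeasurableSet {x : Fin N → X | ε < |(∑ i, a (x i)) / N - ∫ x, a x ∂M.init|} := by
    refine measurableSet_lt measurable_const (Measurable.abs (Measurable.sub_const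
      (Measurable.div_const (Finset.measurable_sum _ fun i _ => ?_) _) _))
    exact ha.comp (measurable_pi_apply i)
  have := hoeffding_pi hN M.init ha hB haB hε
  rw [← hsys.law_init, map_measureReal_apply hsys.meas_init hD] at this
  rw [M.unnormalized_zero hf hh]
  exact this

/-- Given the particles and functionals at time `n`, the mean at time `n + 1` averages `N` i.i.d.
bounded terms, and the subtracted weighted mean is their conditional expectation. -/
lemma concentrates_unnormalizedMean_succ (hs : s.IsBounded)
    (hg_pos : ∀ (v : Y) (x : X), 0 < M.obs v x)
    (hg : ∀ v : Y, ∃ C : ℝ≥0, ∀ x : X, M.obs v x ≤ C) (n : ℕ) {f h : X → ℝ} (hf : Measurable f)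
    (hh : Measurable h) {F H : ℝ} (hF : ∀ x, |f x| ≤ F) (hH : ∀ x, |h x| ≤ H) :
    Concentrates.{_, _, _, w} M y fun N x₀ z =>
      M.unnormalizedMean y s (n + 1) f h N x₀ z - M.weightedMean y s n
      (fun x => ∫ z, (M.obs (y (n + 1)) (M.endpoint z) : ℝ) * f (M.endpoint z) ∂M.trans x)
      (fun x => ∫ z, ((M.obs (y (n + 1)) (M.endpoint z) : ℝ) * f (M.endpoint z) * s.step n x z +
        (M.obs (y (n + 1)) (M.endpoint z) : ℝ) * h (M.endpoint z)) ∂M.trans x) N x₀ z := by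
  obtain ⟨G, hG⟩ := hg (y (n + 1))
  obtain ⟨B, hB0, hB⟩ := M.exists_abs_functional_le y hs n
  obtain ⟨C, hC⟩ := hs.2 n
  obtain ⟨x₁⟩ := M.nonempty_state
  obtain ⟨z₁⟩ := M.nonempty_augmented
  have hC0 : 0 ≤ C := (abs_nonneg _).trans (hC x₁ z₁)
  have hmul : ∀ {p P : ℝ} (x : X), |p| ≤ P →
      |(M.obs (y (n + 1)) x : ℝ) * p| ≤ G * P := fun x hp => by
    rw [abs_mul, abs_of_nonneg (NNReal.coe_nonneg _)]
    exact mul_le_mul (by exact_mod_cast hG x) hp (abs_nonneg _) G.2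
  have hgm : Measurable fun z => (M.obs (y (n + 1)) (M.endpoint z) : ℝ) :=
    ((M.measurable_obs _).comp M.endpoint_meas).coe_nnreal_real
  have hfm := hgm.mul (hf.comp M.endpoint_meas)
  have hhm := hgm.mul (hh.comp M.endpoint_meas)
  -- Hoeffding's inequality needs a uniform bound, so the functionals are clipped at level `B`.
  let clip : ℝ → ℝ := fun t => max (-B) (min t B)
  have hclip : Measurable clip := measurable_const.max (measurable_id.min measurable_const)
  have hclipB : ∀ t, |clip t| ≤ B := fun t =>
    abs_le.2 ⟨le_max_left _ _, max_le (by linarith) (min_le_right _ _)⟩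
  have hclip_eq : ∀ t, |t| ≤ B → clip t = t := fun t ht => by
    simp only [clip, min_eq_left (abs_le.1 ht).2, max_eq_right (abs_le.1 ht).1]
  set R := G * F * (B + C) + G * H
  refine ⟨2, two_pos, 1 / (2 * (|R| + 1) ^ 2), by positivity,
    fun Ω _ P _ N x₀ z hN hsys ε hε => ?_⟩
  let a : (Fin N → X) × (Fin N → ℝ) → Z → ℝ := fun σ z =>
    (M.obs (y (n + 1)) (M.endpoint z) : ℝ) * f (M.endpoint z) *
      M.backwardMean (s.step n) (y n) σ.1 (fun j => clip (σ.2 j)) z +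
      (M.obs (y (n + 1)) (M.endpoint z) : ℝ) * h (M.endpoint z)
  have hpair : Measurable fun p : ((Fin N → X) × (Fin N → ℝ)) × Z =>
      ((p.1.1, fun j => clip (p.1.2 j)), p.2) := by
    refine ((measurable_fst.comp measurable_fst).prodMk (measurable_pi_lambda _ fun j =>
      hclip.comp ((measurable_pi_apply j).comp (measurable_snd.comp measurable_fst)))).prodMk
      measurable_snd
  have ha : Measurable (Function.uncurry a) := by
    have hb := (M.measurable_backwardMean (s.step_meas n) (y n) (N := N)).comp hpair
    exact ((hfm.comp measurable_snd).mul hb).add (hhm.comp measurable_snd)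
  have haB : ∀ σ z, |a σ z| ≤ |R| + 1 := fun σ z =>
    (abs_mul_add_le (hmul _ (hF _)) (M.abs_backwardMean_le hC _ _ (fun j => hclipB _)
      (by positivity) z) (hmul _ (hH _))).trans
      ((le_abs_self R).trans (le_add_of_nonneg_right zero_le_one))
  have hz : Measurable fun ω => (x₀ ω, z ω) := hsys.meas_init.prodMk hsys.meas_step
  have hσ : Measurable fun ω =>
      (M.particle (x₀ ω) (z ω) n, M.functional y s (x₀ ω) (z ω) n) :=
    ((M.measurable_particle n).comp hz).prodMk ((M.measurable_functional y s n).comp hz)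
  have := M.isMarkovKernel_mixtureKernel hg_pos (y n) hN (Fin N → ℝ)
  have key := hoeffding_cond hN hσ ((measurable_pi_apply n).comp hsys.meas_step)
    (M.mixtureKernel (y n) N (Fin N → ℝ)) (fun D A hD hA => hsys.law_next s n D A hD hA) ha
    (by positivity : 0 < |R| + 1) haB hε
  refine le_trans (le_of_eq ?_) key
  congr 1
  ext ω
  -- On functionals produced by the algorithm the clipping is the identity, so the clipped statistic
  -- is the original one.
  have hcl : (fun j => clip (M.functional y s (x₀ ω) (z ω) n j)) =
      M.functional y s (x₀ ω) (z ω) n := funext fun j => hclip_eq _ (hB N _ _ j)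
  have hint := M.integral_mixture_backwardMean (s.step_meas n) hC (y n)
    (M.particle (x₀ ω) (z ω) n) (hB N (x₀ ω) (z ω)) (by positivity) hfm hhm
    (fun z => hmul _ (hF (M.endpoint z))) (fun z => hmul _ (hH (M.endpoint z)))
  have h1 : ∫ z', a (M.particle (x₀ ω) (z ω) n, M.functional y s (x₀ ω) (z ω) n) z'
      ∂M.mixtureKernel (y n) N (Fin N → ℝ)
        (M.particle (x₀ ω) (z ω) n, M.functional y s (x₀ ω) (z ω) n) = M.weightedMean y s n
      (fun x => ∫ z, (M.obs (y (n + 1)) (M.endpoint z) : ℝ) * f (M.endpoint z) ∂M.trans x)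
      (fun x => ∫ z, ((M.obs (y (n + 1)) (M.endpoint z) : ℝ) * f (M.endpoint z) * s.step n x z +
        (M.obs (y (n + 1)) (M.endpoint z) : ℝ) * h (M.endpoint z)) ∂M.trans x)
      N (x₀ ω) (z ω) := by
    simp only [a, hcl]
    exact hint
  have h2 : (∑ i, a (M.particle (x₀ ω) (z ω) n, M.functional y s (x₀ ω) (z ω) n)
      (((fun f : ℕ → Fin N → Z => f n) ∘ z) ω i)) / N =
      M.unnormalizedMean y s (n + 1) f h N (x₀ ω) (z ω) := by
    simp only [a, hcl, unnormalizedMean, Function.comp_apply, functional_succ]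
    congr 1
    refine Finset.sum_congr rfl fun i _ => ?_
    simp only [particle]
    ring
  simp only [Set.mem_ofPred_eq]
  rw [h1, h2]

lemma concentrates_weightedMean_of_unnormalizedMean (hs : s.IsBounded)
    (hg_pos : ∀ (v : Y) (x : X), 0 < M.obs v x) (n : ℕ) {f h : X → ℝ}
    {F H : ℝ} (hF : ∀ x, |f x| ≤ F) (hH : ∀ x, |h x| ≤ H) {a d : ℝ} (hd : 0 < d)
    (h₁ : Concentrates.{_, _, _, w} M y fun N x₀ z => M.unnormalizedMean y s n f h N x₀ z - a)
    (h₂ : Concentrates.{_, _, _, w} M y fun N x₀ z =>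
      M.unnormalizedMean y s n (fun _ => 0) (fun _ => 1) N x₀ z - d) :
    Concentrates.{_, _, _, w} M y fun N x₀ z => M.weightedMean y s n f h N x₀ z - a / d := by
  obtain ⟨B, hB0, hB⟩ := M.exists_abs_functional_le y hs n
  refine h₁.of_abs_le h₂ (K := (1 + |F * B + H|) / d) (by positivity) fun N hN x₀ z => ?_
  have hW := (abs_weightedMean_le y s hg_pos n hF hH hN x₀ z (hB N x₀ z)).trans (le_abs_self _)
  have hmul := weightedMean_mul y s hg_pos n f h hN x₀ z
  set W := M.weightedMean y s n f h N x₀ z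
  set A := M.unnormalizedMean y s n f h N x₀ z
  set D := M.unnormalizedMean y s n (fun _ => 0) (fun _ => 1) N x₀ z
  -- Uses `A = W * D`. As `W` is bounded, only the deterministic `d` needs to stay away from zero,
  -- not the random `D`.
  have heq : W - a / d = ((A - a) + -W * (D - d)) / d := by
    rw [← hmul]; field_simp; ring
  rw [heq, abs_div, abs_of_pos hd, div_mul_eq_mul_div]
  refine div_le_div_of_nonneg_right ?_ hd.le
  refine (abs_add_le _ _).trans ?_
  rw [abs_mul, abs_neg]
  have h3 : |W| * |D - d| ≤ |F * B + H| * |D - d| :=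
    mul_le_mul_of_nonneg_right hW (abs_nonneg _)
  have h4 : 0 ≤ |F * B + H| * |A - a| := by positivity
  have h5 := abs_nonneg (D - d)
  linarith

theorem concentrates_weightedMean (hs : s.IsBounded)
    (hg_pos : ∀ (v : Y) (x : X), 0 < M.obs v x)
    (hg : ∀ v : Y, ∃ C : ℝ≥0, ∀ x : X, M.obs v x ≤ C) (n : ℕ) {f h : X → ℝ} (hf : Measurable f)
    (hh : Measurable h) {F H : ℝ} (hF : ∀ x, |f x| ≤ F) (hH : ∀ x, |h x| ≤ H) :
    Concentrates.{_, _, _, w} M y fun N x₀ z => M.weightedMean y s n f h N x₀ z -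
      M.unnormalized y s n f h / M.unnormalized y s n (fun _ => 0) (fun _ => 1) := by
  have hz : ∀ _ : X, |(0 : ℝ)| ≤ 0 := by simp
  have ho : ∀ _ : X, |(1 : ℝ)| ≤ 1 := by simp
  -- The step calls the hypothesis for the transformed pair `(f', h')`, so the test functions must
  -- vary.
  induction n generalizing f h F H with
  | zero =>
    exact concentrates_weightedMean_of_unnormalizedMean hs hg_pos 0 hF hH
      (M.unnormalized_one_pos hg_pos hg 0)
      (concentrates_unnormalizedMean_zero hs hg hf hh hF hH)
      (concentrates_unnormalizedMean_zero hs hg measurable_const measurable_const hz ho)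
  | succ n ih =>
    have hc : 0 < M.unnormalized y s n (fun _ => 0) (fun _ => 1) :=
      M.unnormalized_one_pos hg_pos hg n
    have hd : 0 < M.unnormalized y s (n + 1) (fun _ => 0) (fun _ => 1) :=
      M.unnormalized_one_pos hg_pos hg (n + 1)
    -- The weights at time `n` are already normalised, so the limit carries the constant of time `n`
    -- as a divisor; it cancels in the final ratio.
    have step : ∀ {f h : X → ℝ}, Measurable f → Measurable h → ∀ {F H : ℝ}, (∀ x, |f x| ≤ F) →
        (∀ x, |h x| ≤ H) → Concentrates.{_, _, _, w} M y fun N x₀ z =>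
          M.unnormalizedMean y s (n + 1) f h N x₀ z - M.unnormalized y s (n + 1) f h /
            M.unnormalized y s n (fun _ => 0) (fun _ => 1) := by
      intro f h hf hh F H hF hH
      obtain ⟨G, hG⟩ := hg (y (n + 1))
      obtain ⟨C, hC⟩ := hs.2 n
      have hmul : ∀ {p P : ℝ} (x : X), |p| ≤ P →
          |(M.obs (y (n + 1)) x : ℝ) * p| ≤ G * P := fun x hp => by
        rw [abs_mul, abs_of_nonneg (NNReal.coe_nonneg _)]
        exact mul_le_mul (by exact_mod_cast hG x) hp (abs_nonneg _) G.2
      have hgm : Measurable fun z => (M.obs (y (n + 1)) (M.endpoint z) : ℝ) :=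
        ((M.measurable_obs _).comp M.endpoint_meas).coe_nnreal_real
      have hfm := (hgm.mul (hf.comp M.endpoint_meas)).comp (measurable_snd : Measurable (Prod.snd : X × Z → Z))
      have hhm := (hgm.mul (hh.comp M.endpoint_meas)).comp (measurable_snd : Measurable (Prod.snd : X × Z → Z))
      refine (concentrates_unnormalizedMean_succ hs hg_pos hg n hf hh hF hH).of_abs_le
        (ih (M.measurable_integral_trans
          (φ := fun _ z => (M.obs (y (n + 1)) (M.endpoint z) : ℝ) * f (M.endpoint z)) hfm)
          (M.measurable_integral_trans (φ := fun x z => (M.obs (y (n + 1)) (M.endpoint z) : ℝ) *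
            f (M.endpoint z) * s.step n x z + (M.obs (y (n + 1)) (M.endpoint z) : ℝ) *
            h (M.endpoint z)) ((hfm.mul (s.step_meas n)).add hhm))
          (M.abs_integral_trans_le fun z => hmul _ (hF _))
          (fun x => M.abs_integral_trans_le
            (fun z => abs_mul_add_le (hmul _ (hF _)) (hC x z) (hmul _ (hH _))) x))
        one_pos fun N _ x₀ z => ?_
      rw [one_mul, M.unnormalized_succ hg hs n hf hh hF hH]
      exact abs_sub_le _ _ _
    have := concentrates_weightedMean_of_unnormalizedMean hs hg_pos (n + 1) hF hH
      (div_pos hd hc) (step hf hh hF hH) (step measurable_const measurable_const hz ho)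
    rwa [div_div_div_cancel_right₀ hc.ne'] at this

theorem concentrates_estimate (hs : s.IsBounded)
    (hg_pos : ∀ (v : Y) (x : X), 0 < M.obs v x)
    (hg : ∀ v : Y, ∃ C : ℝ≥0, ∀ x : X, M.obs v x ≤ C) (n : ℕ) :
    Concentrates.{_, _, _, w} M y fun _ x₀ z =>
      M.smoothingExpectation y s n - M.estimate y s x₀ z n := by
  have h := concentrates_weightedMean.{w, _, _, _} (M := M) (y := y) hs hg_pos hg n
    (f := fun _ => 1) (h := fun _ => 0) measurable_const measurable_const (F := 1) (H := 0)
    (by simp) (by simp)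
  -- Only a change of sign is needed, so the same statistic fills both slots.
  refine h.of_abs_le h one_pos fun N _ x₀ z => ?_
  have : M.weightedMean y s n (fun _ => 1) (fun _ => 0) N x₀ z = M.estimate y s x₀ z n := by
    simp [weightedMean, estimate]
  rw [this, ← M.smoothingExpectation_eq hg, abs_sub_comm, one_mul]
  exact le_add_of_nonneg_left (abs_nonneg _)

/-- Borel–Cantelli: a concentrating statistic tends to zero almost surely. -/
lemma Concentrates.ae_tendsto_zero {V : ∀ N : ℕ, (Fin N → X) → (ℕ → Fin N → Z) → ℝ}
    (hV : Concentrates.{_, _, _, w} M y V) {Ω : Type w} [MeasurableSpace Ω] (P : Measure Ω)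
    [IsProbabilityMeasure P] (x₀ : ∀ N : ℕ, Ω → Fin N → X) (z : ∀ N : ℕ, Ω → ℕ → Fin N → Z)
    (hsys : ∀ N : ℕ, 1 ≤ N → M.IsParticleSystem y P (x₀ N) (z N)) :
    ∀ᵐ ω ∂P, Tendsto (fun N => V N (x₀ N ω) (z N ω)) atTop (𝓝 0) := by
  obtain ⟨b, hb, c, hc, h⟩ := hV
  have hev : ∀ m : ℕ, ∀ᵐ ω ∂P, ∀ᶠ N in atTop, |V N (x₀ N ω) (z N ω)| ≤ 1 / ((m : ℝ) + 1) := by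
    intro m
    set ε : ℝ := 1 / ((m : ℝ) + 1)
    have hε : 0 < ε := by positivity
    have hsum : Summable fun N : ℕ => b * Real.exp (-c * N * ε ^ 2) := by
      refine Summable.mul_left b ?_
      have := Real.summable_exp_nat_mul_of_ge (c := -(c * ε ^ 2)) (neg_lt_zero.2 (by positivity))
        (f := fun N => (N : ℝ)) fun _ => le_rfl
      refine this.congr fun N => ?_
      congr 1; ring
    -- The shift skips `N = 0`, where nothing is assumed about the system. Only the marginal law of
    -- each system enters.
    have hfin : ∑' N, P {ω | ε < |V (N + 1) (x₀ (N + 1) ω) (z (N + 1) ω)|} ≠ ∞ := by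
      have hs' := (summable_nat_add_iff 1).2 hsum
      refine ne_top_of_le_ne_top hs'.tsum_ofReal_ne_top (ENNReal.tsum_le_tsum fun N => ?_)
      rw [ENNReal.le_ofReal_iff_toReal_le (measure_ne_top _ _) (by positivity)]
      exact h Ω P (N + 1) _ _ (by omega) (hsys _ (by omega)) ε hε
    filter_upwards [ae_eventually_notMem hfin] with ω hω
    obtain ⟨N₀, hN₀⟩ := eventually_atTop.1 hω
    filter_upwards [eventually_ge_atTop (N₀ + 1)] with N hN
    obtain ⟨k, rfl⟩ := Nat.exists_eq_add_of_le' ((Nat.le_add_left 1 N₀).trans hN)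
    exact not_lt.1 (hN₀ k (by omega))
  filter_upwards [ae_all_iff.2 hev] with ω hω
  rw [Metric.tendsto_nhds]
  intro ε hε
  obtain ⟨m, hm⟩ := exists_nat_one_div_lt hε
  filter_upwards [hω m] with N hN
  rw [Real.dist_eq, sub_zero]
  exact hN.trans_lt hm

end Model

end PathspaceSmoothing

end

theorem proposition3 {X : Type*} {Z : Type*} {Y : Type*}
    [MeasurableSpace X] [MeasurableSpace Z] [MeasurableSpace Y]
    (M : PathspaceSmoothing.Model X Z Y) (y : ℕ → Y)
    (s : PathspaceSmoothing.AdditiveFunctional X Z) (hs : s.IsBounded)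
    (hg_pos : ∀ (v : Y) (x : X), 0 < M.obs v x)
    (hg_bdd : ∀ v : Y, ∃ C : ℝ≥0, ∀ x : X, M.obs v x ≤ C)
    (hp_bdd : ∃ C : ℝ≥0, ∀ (x : X) (z : Z), M.dens x z ≤ C)
    (n : ℕ) :
    (∃ b : ℝ, 0 < b ∧ ∃ c : ℝ, 0 < c ∧
      ∀ (Ω : Type*) [MeasurableSpace Ω] (P : Measure Ω) [IsProbabilityMeasure P]
        (N : ℕ) (x₀ : Ω → Fin N → X) (z : Ω → ℕ → Fin N → Z),
        1 ≤ N → M.IsParticleSystem y P x₀ z →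
          ∀ ε : ℝ, 0 < ε →
            P.real {ω | ε < |M.smoothingExpectation y s n - M.estimate y s (x₀ ω) (z ω) n|} ≤
              b * Real.exp (-c * N * ε ^ 2)) ∧
    (∀ (Ω : Type*) [MeasurableSpace Ω] (P : Measure Ω) [IsProbabilityMeasure P]
        (x₀ : ∀ N : ℕ, Ω → Fin N → X) (z : ∀ N : ℕ, Ω → ℕ → Fin N → Z),
        (∀ N : ℕ, 1 ≤ N → M.IsParticleSystem y P (x₀ N) (z N)) →
          ∀ᵐ ω ∂P, Tendsto (fun N => M.estimate y s (x₀ N ω) (z N ω) n) atTop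
            (𝓝 (M.smoothingExpectation y s n))) := by
  refine ⟨PathspaceSmoothing.Model.concentrates_estimate hs hg_pos hg_bdd n,
    fun Ω _ P _ x₀ z hsys => ?_⟩
  -- The concentration bound is instantiated afresh because the two halves quantify over `Ω` in
  -- separate universes.
  have h := (PathspaceSmoothing.Model.concentrates_estimate hs hg_pos hg_bdd n).ae_tendsto_zero
    P x₀ z hsys
  filter_upwards [h] with ω hω
  simpa using hω.const_sub (M.smoothingExpectation y s n)
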